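/- For a metric space $(Y,d)$ let $\mathcal W_2(Y)$ be the set of Borel probability measures on $Y$ with finite second moment, with the Wasserstein distance $d_W(\mu,\nu)^2=\inf_{\pi}\int d(x,y)^2\,d\pi(x,y)$, the infimum being over all transport plans $\pi$ between $\mu$ and $\nu$ (measures on $Y\times Y$ with marginals $\mu$ and $\nu$), and with the Borel $\sigma$-algebra of $d_W$. A plan is optimal if it attains the infimum. A barycenter of $\mathbb P\in\mathcal W_2(Y)$ is a point $z\in Y$ minimising $z\mapsto\int_Y d(z,y)^2\,d\mathbb P(y)$. Let $(X,d)$ be a proper metric space, and let $\pi:\mathcal W_2(X)\times\mathcal W_2(X)\to\mathcal W_2(X\times X)$, $(\mu,\nu)\mapsto\pi_\mu^\nu$, be a measurable map such that $\pi_\mu^\nu$ is an optimal transport plan between $\mu$ and $\nu$ for all $\mu,\nu$, where $X\times X$ carries the $\ell^2$ product metric. Let $\mathbb P\in\mathcal W_2(\mathcal W_2(X))$, and let $\mu\in\mathcal W_2(X)$ be a barycenter of $\mathbb P$. Suppose that $\mu=\lambda\mu^1+(1-\lambda)\mu^2$ with $\lambda\in(0,1)$ and $\mu^1,\mu^2\in\mathcal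 W_2(X)$. For $i\in\{1,2\}$ let $g_i$ be the density of $\mu^i$ with respect to $\mu$, let $\mathcal R^i:\mathcal W_2(X)\to\mathcal W_2(X)$ be the restriction mapping $\mathcal R^i(\nu)=p_{2\#}\big(g_i(x)\,\pi_\mu^\nu(dx,dy)\big)$, where $p_2(x,y)=y$, and let $\mathbb Q^i=\mathcal R^i_{\#}\mathbb P$. Let $\eta$ be any Borel measure on $X$ and put $A_\eta=\{\nu\in\mathcal W_2(X):\nu\ll\eta\}$. Then, for $i=1,2$: 1. if $\mathbb P(A_\eta)>0$, then $\mathbb Q^i(A_\eta)>0$; 2. if $\mathbb P(A_\eta)=1$, then $\mathbb Q^i(A_\eta)=1$. (If $\eta$ is such that $A_\eta$ is not Borel, $\mathbb P(A_\eta)$ and $\mathbb Q^i(A_\eta)$ are outer measures.) -/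

import Mathlib

open MeasureTheory Set
open scoped ENNReal

noncomputable section

/-- The quadratic Wasserstein space over `X`: the probability measures with finite second moment
(about some, equivalently about any, base point). For a metric space, `X` carries its Borel
sigma-algebra. -/
structure W2 (X : Type*) [MeasurableSpace X] [EDist X] where
  /-- the underlying measure -/
  toMeasure : Measure X
  isProb : IsProbabilityMeasure toMeasure
  moment : ∃ x₀ : X, ∫⁻ x, edist x₀ x ^ 2 ∂toMeasure < ∞

namespace W2

instance {X : Type*} [MeasurableSpace X] [EDist X] (μ : W2 X) :
    IsProbabilityMeasure μ.toMeasure := μ.isProb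

end W2

/-- The transport plans between `μ` and `ν`: measures on the product with marginals `μ`, `ν`. -/
def transportPlans {X : Type*} [MeasurableSpace X] (μ ν : Measure X) : Set (Measure (X × X)) :=
  {θ | θ.map Prod.fst = μ ∧ θ.map Prod.snd = ν}

/-- The quadratic cost of a plan. -/
def transportCost {X : Type*} [MeasurableSpace X] [EDist X] (θ : Measure (X × X)) : ℝ≥0∞ :=
  ∫⁻ z, edist z.1 z.2 ^ 2 ∂θ

namespace W2

/-- The Wasserstein distance `d_W` (as an extended distance). -/
instance instEDist {X : Type*} [MeasurableSpace X] [EDist X] : EDist (W2 X) where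
  edist μ ν := (⨅ θ ∈ transportPlans μ.toMeasure ν.toMeasure, transportCost θ) ^ (1 / 2 : ℝ)

/-- The topology of the Wasserstein distance, generated by the open balls of `d_W`. -/
instance instTopologicalSpace {X : Type*} [MeasurableSpace X] [EDist X] :
    TopologicalSpace (W2 X) :=
  TopologicalSpace.generateFrom
    {B | ∃ (μ : W2 X) (r : ℝ≥0∞), B = {ν | edist ν μ < r}}

/-- The Wasserstein space carries the Borel sigma-algebra of `d_W`; in particular
`W2 (W2 X)` is the Wasserstein space over the Wasserstein space. -/
instance instMeasurableSpace {X : Type*} [MeasurableSpace X] [EDist X] :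
    MeasurableSpace (W2 X) := borel (W2 X)

instance instBorelSpace {X : Type*} [MeasurableSpace X] [EDist X] :
    BorelSpace (W2 X) := ⟨rfl⟩

end W2

/-- The optimal transport plans between `μ` and `ν`: the plans whose cost is `d_W(μ, ν)²`. -/
def optimalPlans {X : Type*} [MeasurableSpace X] [EDist X] (μ ν : W2 X) :
    Set (Measure (X × X)) :=
  {θ | θ ∈ transportPlans μ.toMeasure ν.toMeasure ∧ transportCost θ = edist μ ν ^ 2}

/-- `z` is a barycenter of `P`: it minimises `w ↦ ∫ d(w, y)² dP(y)`. -/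
def IsBarycenter {Y : Type*} [MeasurableSpace Y] [EDist Y] (P : W2 Y) (z : Y) : Prop :=
  ∀ w : Y, ∫⁻ y, edist z y ^ 2 ∂P.toMeasure ≤ ∫⁻ y, edist w y ^ 2 ∂P.toMeasure

/-- A measurable selection of optimal plans: a Borel map `W2(X) × W2(X) → W2(X²)`, where `X²` has
the `ℓ²` product metric (this is `WithLp 2 (X × X)`), sending `(μ, ν)` to an optimal plan. -/
structure OptimalSelection (X : Type*) [MeasurableSpace X] [EDist X] where
  /-- the selected plan -/
  plan : W2 X × W2 X → W2 (WithLp 2 (X × X))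
  measurable_plan : Measurable plan
  optimal : ∀ μ ν : W2 X,
    (plan (μ, ν)).toMeasure.map WithLp.ofLp ∈ optimalPlans μ ν

/-- A decomposition `μ = t μ⁰ + (1 - t) μ¹` of `μ ∈ W2(X)` as a convex combination of two elements
of `W2(X)`, with `t ∈ (0, 1)`. -/
structure Decomposition {X : Type*} [MeasurableSpace X] [EDist X] (μ : W2 X) where
  /-- the coefficient of the first part -/
  t : ℝ
  ht : t ∈ Ioo (0 : ℝ) 1
  /-- the two parts -/
  part : Fin 2 → W2 X
  eq : μ.toMeasure =
    ENNReal.ofReal t • (part 0).toMeasure + ENNReal.ofReal (1 - t) • (part 1).toMeasure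

namespace Decomposition

variable {X : Type*} [MeasurableSpace X] [EDist X] {μ : W2 X}

/-- The density `g_i` of the `i`-th part with respect to `μ`. -/
def density (D : Decomposition μ) (i : Fin 2) : X → ℝ≥0∞ :=
  (D.part i).toMeasure.rnDeriv μ.toMeasure

/-- The measure `ν^i = p₂# (g_i π_μ^ν)`, where `g_i` is evaluated at the first coordinate. -/
def restrictMeasure (D : Decomposition μ) (S : OptimalSelection X) (i : Fin 2) (ν : W2 X) :
    Measure X :=
  ((((S.plan (μ, ν)).toMeasure.map WithLp.ofLp).withDensity
    (fun z : X × X => D.density i z.1)).map Prod.snd)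

theorem measurable_density (D : Decomposition μ) (i : Fin 2) : Measurable (D.density i) :=
  Measure.measurable_rnDeriv _ _

theorem exists_smul_le (D : Decomposition μ) (i : Fin 2) :
    ∃ c : ℝ≥0∞, c ≠ 0 ∧ c ≠ ∞ ∧ c • (D.part i).toMeasure ≤ μ.toMeasure := by
  obtain ⟨h0, h1⟩ := D.ht
  have h2 : 0 < 1 - D.t := by linarith
  fin_cases i
  · refine ⟨ENNReal.ofReal D.t, by simpa using h0, ENNReal.ofReal_ne_top, ?_⟩
    conv_rhs => rw [D.eq]
    exact Measure.le_add_right le_rfl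
  · refine ⟨ENNReal.ofReal (1 - D.t), by simpa using h1, ENNReal.ofReal_ne_top, ?_⟩
    conv_rhs => rw [D.eq]
    exact Measure.le_add_left le_rfl

theorem absolutelyContinuous (D : Decomposition μ) (i : Fin 2) :
    (D.part i).toMeasure ≪ μ.toMeasure := by
  obtain ⟨c, hc0, -, hc⟩ := D.exists_smul_le i
  intro s hs
  have h := hc s
  rw [hs] at h
  simpa [hc0] using h

/-- The part is indeed `g_i μ`. -/
theorem withDensity_density (D : Decomposition μ) (i : Fin 2) :
    μ.toMeasure.withDensity (D.density i) = (D.part i).toMeasure :=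
  Measure.withDensity_rnDeriv_eq _ _ (D.absolutelyContinuous i)

/-- The density is bounded. -/
theorem exists_density_le (D : Decomposition μ) (i : Fin 2) :
    ∃ K : ℝ≥0∞, K ≠ ∞ ∧ ∀ᵐ x ∂μ.toMeasure, D.density i x ≤ K := by
  obtain ⟨c, hc0, hct, hc⟩ := D.exists_smul_le i
  refine ⟨c⁻¹, by simpa using hc0, ?_⟩
  have h1 := Measure.rnDeriv_le_one_of_le hc
  have h2 := Measure.rnDeriv_smul_left_of_ne_top (D.part i).toMeasure μ.toMeasure hct
  filter_upwards [h1, h2] with x h1 h2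
  rw [h2] at h1
  simp only [Pi.smul_apply, smul_eq_mul, Pi.one_apply] at h1
  rw [ENNReal.le_inv_iff_mul_le, mul_comm]
  exact h1

theorem isProb_restrictMeasure (D : Decomposition μ) (S : OptimalSelection X) (i : Fin 2)
    (ν : W2 X) : IsProbabilityMeasure (D.restrictMeasure S i ν) := by
  obtain ⟨⟨h1, -⟩, -⟩ := S.optimal μ ν
  constructor
  rw [restrictMeasure, Measure.map_apply measurable_snd MeasurableSet.univ, preimage_univ,
    withDensity_apply _ MeasurableSet.univ, Measure.restrict_univ,
    ← lintegral_map (D.measurable_density i) measurable_fst, h1]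
  have h := congrArg (fun m : Measure X => m univ) (D.withDensity_density i)
  simp only [withDensity_apply _ MeasurableSet.univ, Measure.restrict_univ, measure_univ] at h
  exact h

theorem exists_restrictMeasure_le (D : Decomposition μ) (S : OptimalSelection X) (i : Fin 2)
    (ν : W2 X) : ∃ K : ℝ≥0∞, K ≠ ∞ ∧ D.restrictMeasure S i ν ≤ K • ν.toMeasure := by
  obtain ⟨⟨h1, h2⟩, -⟩ := S.optimal μ ν
  obtain ⟨K, hK, hle⟩ := D.exists_density_le i
  refine ⟨K, hK, ?_⟩
  rw [restrictMeasure, ← h2, ← Measure.map_smul]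
  refine Measure.map_mono ?_ measurable_snd
  rw [← withDensity_const]
  refine withDensity_mono ?_
  rw [← h1] at hle
  exact ae_of_ae_map measurable_fst.aemeasurable hle

/-- The restriction mapping `R^i : W2(X) → W2(X)`, `ν ↦ ν^i`. -/
def restriction (D : Decomposition μ) (S : OptimalSelection X) (i : Fin 2) (ν : W2 X) : W2 X where
  toMeasure := D.restrictMeasure S i ν
  isProb := D.isProb_restrictMeasure S i ν
  moment := by
    obtain ⟨x₀, hx₀⟩ := ν.moment
    obtain ⟨K, hK, hle⟩ := D.exists_restrictMeasure_le S i ν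
    refine ⟨x₀, (lintegral_mono' hle le_rfl).trans_lt ?_⟩
    rw [lintegral_smul_measure]
    exact ENNReal.mul_lt_top hK.lt_top hx₀

end Decomposition

/-- The measures in `W2(X)` that are absolutely continuous with respect to `η`. -/
def acMeasures {X : Type*} [MeasurableSpace X] [EDist X] (η : Measure X) : Set (W2 X) :=
  {ν | ν.toMeasure ≪ η}

end

/-! Since a positive multiple of the part `D.part i` lies below `μ`, its density is bounded by some
`K`. Reweighting a plan from `μ` to `ν` by this density therefore gives at most `K` times the plan,
and projecting gives `R^i(ν) ≤ K ν`. Hence `R^i` preserves absolute continuity with respect to `η`,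
so `A_η` lies in its own preimage under `R^i`, and both claims follow by monotonicity.

The real work is that `R^i` is Borel, without which the pushforward is meaningless. The selection is
only measurable in `ν`, but `R^i(ν)` depends continuously on the selected plan
(`exists_transportPlan_restrict_le`). A coupling of two nearby plans moves both coordinates little:
the weights nearly agree on average by an `L¹` approximation (`exists_lintegral_edist_comp_le`), the
common weight travels along the coupling, and the small leftover is sent anywhere, its cost
controlled by the second moment of the limit (`exists_transportPlan_withDensity`). Thus `R^i` is a
continuous function of a Borel one. -/

section

open ProbabilityTheory Filter Topology

/-! ### Gluing of plans and the triangle inequality for `d_W`. -/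

/-- Minkowski's inequality for the `L²` size of distances. -/
theorem lintegral_edist_sq_rpow_triangle {X W : Type*} [PseudoEMetricSpace X] [MeasurableSpace W]
    {τ : Measure W} {p q r : W → X} (h₁ : Measurable fun w => edist (p w) (q w))
    (h₂ : Measurable fun w => edist (q w) (r w)) :
    (∫⁻ w, edist (p w) (r w) ^ 2 ∂τ) ^ (1 / 2 : ℝ) ≤
      (∫⁻ w, edist (p w) (q w) ^ 2 ∂τ) ^ (1 / 2 : ℝ) +
        (∫⁻ w, edist (q w) (r w) ^ 2 ∂τ) ^ (1 / 2 : ℝ) := by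
  have h := ENNReal.lintegral_Lp_add_le (μ := τ) (p := 2) h₁.aemeasurable h₂.aemeasurable
    one_le_two
  simp only [Pi.add_apply, ENNReal.rpow_two] at h
  refine le_trans ?_ h
  gcongr
  exact edist_triangle _ _ _

/-- The gluing lemma: two plans sharing a marginal come from a measure on the triple product. -/
theorem exists_gluing {X : Type*} [MeasurableSpace X] [StandardBorelSpace X] [Nonempty X]
    {μ ρ ν : Measure X} [IsFiniteMeasure ρ] {θ₁ θ₂ : Measure (X × X)}
    (h₁ : θ₁ ∈ transportPlans μ ρ) (h₂ : θ₂ ∈ transportPlans ρ ν) :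
    ∃ τ : Measure (X × X × X), τ.map (fun p => (p.2.1, p.1)) = θ₁ ∧
      τ.map (fun p => (p.1, p.2.2)) = θ₂ := by
  have fin₁ : IsFiniteMeasure θ₁ := by
    constructor
    have : θ₁ univ = ρ univ := by
      rw [← h₁.2, Measure.map_apply measurable_snd MeasurableSet.univ, preimage_univ]
    rw [this]; exact measure_lt_top _ _
  have fin₂ : IsFiniteMeasure θ₂ := by
    constructor
    have : θ₂ univ = ρ univ := by
      rw [← h₂.1, Measure.map_apply measurable_fst MeasurableSet.univ, preimage_univ]
    rw [this]; exact measure_lt_top _ _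
  have d₁ : ρ ⊗ₘ (θ₁.map Prod.swap).condKernel = θ₁.map Prod.swap := by
    have h := (θ₁.map Prod.swap).disintegrate (θ₁.map Prod.swap).condKernel
    have hfst : (θ₁.map Prod.swap).fst = ρ := by
      rw [Measure.fst, Measure.map_map measurable_fst measurable_swap, ← h₁.2]; rfl
    rwa [hfst] at h
  have d₂ : ρ ⊗ₘ θ₂.condKernel = θ₂ := by
    have h := θ₂.disintegrate θ₂.condKernel
    have hfst : θ₂.fst = ρ := h₂.1
    rwa [hfst] at h
  -- The shared coordinate comes first; given it, the two outer coordinates are drawn independently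
  -- from the conditional laws. The swap lets `θ₁` be disintegrated over its second marginal.
  refine ⟨ρ ⊗ₘ ((θ₁.map Prod.swap).condKernel ×ₖ θ₂.condKernel), ?_, ?_⟩
  · have hs : θ₁ = (ρ ⊗ₘ (θ₁.map Prod.swap).condKernel).map Prod.swap := by
      rw [d₁, Measure.map_map measurable_swap measurable_swap, Prod.swap_swap_eq, Measure.map_id]
    conv_rhs => rw [hs]
    refine Measure.ext_of_lintegral _ fun f hf => ?_
    rw [lintegral_map hf (by fun_prop), lintegral_map hf measurable_swap,
      Measure.lintegral_compProd (by fun_prop), Measure.lintegral_compProd (by fun_prop)]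
    refine lintegral_congr fun a => ?_
    rw [Kernel.lintegral_prod _ _ _ (by fun_prop)]
    simp
  · conv_rhs => rw [← d₂]
    refine Measure.ext_of_lintegral _ fun f hf => ?_
    rw [lintegral_map hf (by fun_prop),
      Measure.lintegral_compProd (by fun_prop), Measure.lintegral_compProd hf]
    refine lintegral_congr fun a => ?_
    rw [Kernel.lintegral_prod _ _ _ (by fun_prop)]
    simp

namespace W2

theorem edist_le_of_mem_transportPlans {X : Type*} [MeasurableSpace X] [EDist X] {μ ν : W2 X}
    {θ : Measure (X × X)} (hθ : θ ∈ transportPlans μ.toMeasure ν.toMeasure) :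
    edist μ ν ≤ transportCost θ ^ (1 / 2 : ℝ) :=
  ENNReal.rpow_le_rpow (iInf₂_le θ hθ) (by norm_num)

theorem exists_plan_of_edist_lt {X : Type*} [MeasurableSpace X] [EDist X] {μ ν : W2 X} {r : ℝ≥0∞}
    (h : edist μ ν < r) :
    ∃ θ ∈ transportPlans μ.toMeasure ν.toMeasure, transportCost θ ^ (1 / 2 : ℝ) < r := by
  have h' : ⨅ θ ∈ transportPlans μ.toMeasure ν.toMeasure, transportCost θ < r ^ (2 : ℝ) := by
    have h2 := ENNReal.rpow_lt_rpow h (z := 2) (by norm_num)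
    rwa [show edist μ ν = (⨅ θ ∈ transportPlans μ.toMeasure ν.toMeasure, transportCost θ) ^
      (1 / 2 : ℝ) from rfl, ← ENNReal.rpow_mul, one_div, inv_mul_cancel₀ two_ne_zero,
      ENNReal.rpow_one] at h2
  obtain ⟨θ, hθ, hlt⟩ := by simpa only [iInf_lt_iff, exists_prop] using h'
  refine ⟨θ, hθ, ?_⟩
  have h3 := ENNReal.rpow_lt_rpow hlt (z := 1 / 2) (by norm_num)
  rwa [← ENNReal.rpow_mul, one_div, mul_inv_cancel₀ two_ne_zero, ENNReal.rpow_one, ← one_div] at h3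

theorem edist_self {X : Type*} [MeasurableSpace X] [PseudoEMetricSpace X] (μ : W2 X) :
    edist μ μ = 0 := by
  have hm : Measurable fun x : X => (x, x) := by fun_prop
  have hmem : μ.toMeasure.map (fun x => (x, x)) ∈ transportPlans μ.toMeasure μ.toMeasure := by
    constructor
    · rw [Measure.map_map measurable_fst hm]; exact Measure.map_id
    · rw [Measure.map_map measurable_snd hm]; exact Measure.map_id
  have hcost : transportCost (μ.toMeasure.map fun x => (x, x)) = 0 := by
    refine le_antisymm ((lintegral_map_le _ _).trans ?_) (zero_le)
    simp
  refine le_antisymm ((edist_le_of_mem_transportPlans hmem).trans ?_) (zero_le)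
  rw [hcost]
  simp

/-- Glue nearly optimal plans along `ρ` and apply Minkowski in `L²` of the glued measure; no optimal
plan is needed, only an error `ε / 2` on each side. -/
theorem edist_triangle {X : Type*} [PseudoEMetricSpace X] [SecondCountableTopology X]
    [MeasurableSpace X] [BorelSpace X] [StandardBorelSpace X] (μ ρ ν : W2 X) :
    edist μ ν ≤ edist μ ρ + edist ρ ν := by
  have : Nonempty X := ⟨μ.moment.choose⟩
  refine ENNReal.le_of_forall_pos_le_add fun ε hε hfin => ?_
  have hε' : (ε / 2 : ℝ≥0∞) ≠ 0 := by simpa using hε.ne'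
  obtain ⟨h₁, h₂⟩ := ENNReal.add_lt_top.1 hfin
  obtain ⟨θ₁, hθ₁, hc₁⟩ := exists_plan_of_edist_lt (ENNReal.lt_add_right h₁.ne hε')
  obtain ⟨θ₂, hθ₂, hc₂⟩ := exists_plan_of_edist_lt (ENNReal.lt_add_right h₂.ne hε')
  obtain ⟨τ, hτ₁, hτ₂⟩ := exists_gluing hθ₁ hθ₂
  have hcm : Measurable fun z : X × X => edist z.1 z.2 ^ 2 := by fun_prop
  have m₁ : Measurable fun p : X × X × X => (p.2.1, p.1) := by fun_prop
  have m₂ : Measurable fun p : X × X × X => (p.1, p.2.2) := by fun_prop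
  have hmem : τ.map (fun p => p.2) ∈ transportPlans μ.toMeasure ν.toMeasure := by
    constructor
    · rw [← hθ₁.1, ← hτ₁, Measure.map_map measurable_fst measurable_snd,
        Measure.map_map measurable_fst m₁]
      rfl
    · rw [← hθ₂.2, ← hτ₂, Measure.map_map measurable_snd measurable_snd,
        Measure.map_map measurable_snd m₂]
      rfl
  calc edist μ ν ≤ transportCost (τ.map fun p => p.2) ^ (1 / 2 : ℝ) :=
        edist_le_of_mem_transportPlans hmem
    _ = (∫⁻ p, edist p.2.1 p.2.2 ^ 2 ∂τ) ^ (1 / 2 : ℝ) := by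
        rw [transportCost, lintegral_map hcm measurable_snd]
    _ ≤ (∫⁻ p, edist p.2.1 p.1 ^ 2 ∂τ) ^ (1 / 2 : ℝ) +
          (∫⁻ p, edist p.1 p.2.2 ^ 2 ∂τ) ^ (1 / 2 : ℝ) :=
        lintegral_edist_sq_rpow_triangle (by fun_prop) (by fun_prop)
    _ = transportCost θ₁ ^ (1 / 2 : ℝ) + transportCost θ₂ ^ (1 / 2 : ℝ) := by
        rw [← hτ₁, ← hτ₂, transportCost, transportCost, lintegral_map hcm m₁,
          lintegral_map hcm m₂]
    _ ≤ (edist μ ρ + ε / 2) + (edist ρ ν + ε / 2) := add_le_add hc₁.le hc₂.le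
    _ = edist μ ρ + edist ρ ν + ε := by
        rw [add_add_add_comm, ENNReal.add_halves]

end W2

/-! ### Stability of reweighted second marginals under perturbation of the plan. -/

theorem map_withDensity_comp {W Z : Type*} [MeasurableSpace W] [MeasurableSpace Z]
    (γ : Measure W) {T : W → Z} (hT : Measurable T) {f : Z → ℝ≥0∞} (hf : Measurable f) :
    (γ.withDensity fun w => f (T w)).map T = (γ.map T).withDensity f := by
  ext s hs
  rw [Measure.map_apply hT hs, withDensity_apply _ (hT hs), withDensity_apply _ hs,
    setLIntegral_map hs hf hT]

theorem edist_sq_le_two_mul {X : Type*} [PseudoEMetricSpace X] (x y z : X) :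
    edist x z ^ 2 ≤ 2 * edist x y ^ 2 + 2 * edist y z ^ 2 := by
  have h := ENNReal.rpow_add_le_mul_rpow_add_rpow (edist x y) (edist y z) one_le_two
  simp only [ENNReal.rpow_two] at h
  rw [← mul_add]
  calc edist x z ^ 2 ≤ (edist x y + edist y z) ^ 2 := by gcongr; exact edist_triangle _ _ _
    _ ≤ _ := by
      refine h.trans_eq ?_
      norm_num

/-- A plan between the images of `a γ` and `b γ`: the common part `min a b` moves along `γ`, the
leftovers are coupled independently. -/
theorem exists_transportPlan_withDensity {X W : Type*} [PseudoEMetricSpace X]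
    [SecondCountableTopology X] [MeasurableSpace X] [BorelSpace X] [MeasurableSpace W]
    (γ : Measure W) {a b : W → ℝ≥0∞} (ha : Measurable a) (hb : Measurable b)
    (hab : ∫⁻ w, a w ∂γ = ∫⁻ w, b w ∂γ) (hfin : ∫⁻ w, a w ∂γ ≠ ∞)
    {p q : W → X} (hp : Measurable p) (hq : Measurable q) (o : X) :
    ∃ σ ∈ transportPlans ((γ.withDensity a).map p) ((γ.withDensity b).map q),
      transportCost σ ≤ ∫⁻ w, min (a w) (b w) * edist (p w) (q w) ^ 2 ∂γ +
        (2 * ∫⁻ w, (a w - b w) * edist o (p w) ^ 2 ∂γ +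
          2 * ∫⁻ w, (b w - a w) * edist o (q w) ^ 2 ∂γ) := by
  have hm : Measurable fun w => min (a w) (b w) := ha.min hb
  have hab' : Measurable fun w => a w - b w := ha.sub hb
  have hba' : Measurable fun w => b w - a w := hb.sub ha
  set A := (γ.withDensity fun w => a w - b w).map p with hA
  set B := (γ.withDensity fun w => b w - a w).map q with hB
  have ea : ∀ w, min (a w) (b w) + (a w - b w) = a w := fun w => by
    rcases le_total (a w) (b w) with h | h
    · rw [min_eq_left h, tsub_eq_zero_of_le h, add_zero]
    · rw [min_eq_right h, add_tsub_cancel_of_le h]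
  have eb : ∀ w, min (a w) (b w) + (b w - a w) = b w := fun w => by
    rcases le_total (a w) (b w) with h | h
    · rw [min_eq_left h, add_tsub_cancel_of_le h]
    · rw [min_eq_right h, tsub_eq_zero_of_le h, add_zero]
  have hAm : A univ = ∫⁻ w, (a w - b w) ∂γ := by
    rw [hA, Measure.map_apply hp MeasurableSet.univ, preimage_univ,
      withDensity_apply _ MeasurableSet.univ, Measure.restrict_univ]
  have hBm : B univ = ∫⁻ w, (b w - a w) ∂γ := by
    rw [hB, Measure.map_apply hq MeasurableSet.univ, preimage_univ,
      withDensity_apply _ MeasurableSet.univ, Measure.restrict_univ]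
  have hsa : ∫⁻ w, min (a w) (b w) ∂γ + A univ = ∫⁻ w, a w ∂γ := by
    rw [hAm, ← lintegral_add_left hm]; simp_rw [ea]
  have hsb : ∫⁻ w, min (a w) (b w) ∂γ + B univ = ∫⁻ w, b w ∂γ := by
    rw [hBm, ← lintegral_add_left hm]; simp_rw [eb]
  have hmin : ∫⁻ w, min (a w) (b w) ∂γ ≠ ∞ := ne_top_of_le_ne_top hfin (hsa ▸ le_self_add)
  have hAB : A univ = B univ := by
    rw [← hab, ← hsa] at hsb
    exact ((ENNReal.add_right_inj hmin).1 hsb).symm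
  have hAfin : A univ ≠ ∞ := ne_top_of_le_ne_top hfin (hsa ▸ le_add_self)
  have : IsFiniteMeasure A := ⟨hAfin.lt_top⟩
  have : IsFiniteMeasure B := ⟨hAB ▸ hAfin.lt_top⟩
  -- The leftovers have equal mass, so dividing their product by that mass gives the right
  -- marginals. If the mass is zero the inverse is `∞`, but both leftovers vanish.
  have hscaleA : ((A univ)⁻¹ * B univ) • A = A := by
    by_cases h0 : A univ = 0
    · simp [Measure.measure_univ_eq_zero.1 h0]
    · rw [← hAB, ENNReal.inv_mul_cancel h0 hAfin, one_smul]
  have hscaleB : ((A univ)⁻¹ * A univ) • B = B := by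
    by_cases h0 : A univ = 0
    · simp [Measure.measure_univ_eq_zero.1 (hAB ▸ h0)]
    · rw [ENNReal.inv_mul_cancel h0 hAfin, one_smul]
  have hcm : Measurable fun z : X × X => edist z.1 z.2 ^ 2 := by fun_prop
  have hpq : Measurable fun w => (p w, q w) := hp.prodMk hq
  refine ⟨(γ.withDensity fun w => min (a w) (b w)).map (fun w => (p w, q w)) +
    (A univ)⁻¹ • A.prod B, ⟨?_, ?_⟩, ?_⟩
  · rw [Measure.map_add _ _ measurable_fst, Measure.map_smul, Measure.map_fst_prod, smul_smul,
      hscaleA, Measure.map_map measurable_fst hpq, hA]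
    change (γ.withDensity _).map p + _ = _
    rw [← Measure.map_add _ _ hp, ← withDensity_add_left hm]
    congr 2
    exact funext ea
  · rw [Measure.map_add _ _ measurable_snd, Measure.map_smul, Measure.map_snd_prod, smul_smul,
      hscaleB, Measure.map_map measurable_snd hpq, hB]
    change (γ.withDensity _).map q + _ = _
    rw [← Measure.map_add _ _ hq, ← withDensity_add_left hm]
    congr 2
    exact funext eb
  · rw [transportCost, lintegral_add_measure, lintegral_smul_measure, lintegral_map hcm hpq,
      lintegral_withDensity_eq_lintegral_mul _ hm (by fun_prop)]
    refine add_le_add le_rfl ?_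
    have hop : ∫⁻ x, edist o x ^ 2 ∂A = ∫⁻ w, (a w - b w) * edist o (p w) ^ 2 ∂γ := by
      rw [hA, lintegral_map (by fun_prop) hp,
        lintegral_withDensity_eq_lintegral_mul _ hab' (by fun_prop)]
      rfl
    have hoq : ∫⁻ x, edist o x ^ 2 ∂B = ∫⁻ w, (b w - a w) * edist o (q w) ^ 2 ∂γ := by
      rw [hB, lintegral_map (by fun_prop) hq,
        lintegral_withDensity_eq_lintegral_mul _ hba' (by fun_prop)]
      rfl
    rw [← hop, ← hoq]
    have hbound : ∫⁻ z, edist z.1 z.2 ^ 2 ∂A.prod B ≤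
        A univ * (2 * ∫⁻ x, edist o x ^ 2 ∂A + 2 * ∫⁻ x, edist o x ^ 2 ∂B) := by
      calc ∫⁻ z, edist z.1 z.2 ^ 2 ∂A.prod B
          ≤ ∫⁻ z, (2 * edist o z.1 ^ 2 + 2 * edist o z.2 ^ 2) ∂A.prod B := by
            refine lintegral_mono fun z => ?_
            rw [edist_comm o z.1]
            exact edist_sq_le_two_mul _ _ _
        _ = 2 * ∫⁻ z, edist o z.1 ^ 2 ∂A.prod B + 2 * ∫⁻ z, edist o z.2 ^ 2 ∂A.prod B := by
            rw [lintegral_add_left (by fun_prop), lintegral_const_mul _ (by fun_prop),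
              lintegral_const_mul _ (by fun_prop)]
        _ = _ := by
            rw [← lintegral_map (μ := A.prod B) (f := fun x => edist o x ^ 2) (by fun_prop)
                measurable_fst,
              ← lintegral_map (μ := A.prod B) (f := fun x => edist o x ^ 2) (by fun_prop)
                measurable_snd,
              Measure.map_fst_prod, Measure.map_snd_prod, lintegral_smul_measure,
              lintegral_smul_measure, ← hAB]
            simp only [smul_eq_mul]
            ring
    calc (A univ)⁻¹ * ∫⁻ z, edist z.1 z.2 ^ 2 ∂A.prod B
        ≤ (A univ)⁻¹ * (A univ * (2 * ∫⁻ x, edist o x ^ 2 ∂A + 2 * ∫⁻ x, edist o x ^ 2 ∂B)) := by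
          gcongr
      _ ≤ _ := by
          rw [← mul_assoc]
          exact mul_le_of_le_one_left (zero_le) (ENNReal.inv_mul_le_one _)

/-- A bounded function in `L¹(μ)` varies little, on average, along self-couplings of `μ` with small
quadratic cost. -/
theorem exists_lintegral_edist_comp_le {X : Type*} [MetricSpace X] [ProperSpace X]
    [MeasurableSpace X] [BorelSpace X] (μ : Measure X) [IsProbabilityMeasure μ]
    {f : X → ℝ} (hf : MemLp f 1 μ) (hfm : Measurable f) {ε : ℝ≥0∞} (hε : ε ≠ 0) :
    ∃ δ : ℝ≥0∞, δ ≠ 0 ∧ ∀ γ ∈ transportPlans μ μ, transportCost γ ≤ δ →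
      ∫⁻ z, edist (f z.1) (f z.2) ∂γ ≤ ε := by
  have hε4 : ε / 4 ≠ 0 := ENNReal.div_ne_zero.2 ⟨hε, by norm_num⟩
  obtain ⟨φ, hφs, hφ, hφc, -⟩ := hf.exists_hasCompactSupport_eLpNorm_sub_le ENNReal.one_ne_top hε4
  have hφ' : ∫⁻ x, edist (f x) (φ x) ∂μ ≤ ε / 4 := by
    simpa [eLpNorm_one_eq_lintegral_enorm, edist_eq_enorm_sub] using hφ
  obtain ⟨M, hM⟩ := hφs.exists_bound_of_continuous hφc
  obtain ⟨r', hr', hunif⟩ := EMetric.uniformContinuous_iff.1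
    (hφs.uniformContinuous_of_continuous hφc) (ε / 4) (pos_iff_ne_zero.2 hε4)
  -- The cap at `1` keeps `r` finite, so that `r ^ 2` can be cancelled in `C`.
  set r := min r' 1 with hr
  have hr0 : r ^ 2 ≠ 0 := pow_ne_zero _ (lt_min hr' one_pos).ne'
  have hrt : r ^ 2 ≠ ∞ := ENNReal.pow_ne_top (ne_top_of_le_ne_top ENNReal.one_ne_top
    (min_le_right _ _))
  set C := ENNReal.ofReal (M + M) / r ^ 2 with hC
  have hCt : C ≠ ∞ := ENNReal.div_ne_top ENNReal.ofReal_ne_top hr0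
  -- Close points are handled by uniform continuity. For distant ones `edist x y ^ 2 / r ^ 2` is at
  -- least `1` and multiplies the trivial bound `M + M`.
  have hpt : ∀ x y, edist (φ x) (φ y) ≤ ε / 4 + C * edist x y ^ 2 := fun x y => by
    rcases lt_or_ge (edist x y) r with h | h
    · exact (hunif (h.trans_le (min_le_left _ _))).le.trans le_self_add
    · refine le_trans ?_ le_add_self
      calc edist (φ x) (φ y) ≤ ENNReal.ofReal (M + M) := by
            rw [edist_dist]
            exact ENNReal.ofReal_le_ofReal ((dist_le_norm_add_norm _ _).trans
              (add_le_add (hM x) (hM y)))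
        _ = C * r ^ 2 := (ENNReal.div_mul_cancel hr0 hrt).symm
        _ ≤ C * edist x y ^ 2 := by gcongr
  -- Two quarters of `ε` pay for replacing `f` by `φ`, one for close pairs, one for distant pairs.
  -- If `C = 0` this `δ` is `∞`, which is harmless.
  refine ⟨ε / 4 / C, ENNReal.div_ne_zero.2 ⟨hε4, hCt⟩, fun γ hγ hcost => ?_⟩
  have hφm : Measurable φ := hφc.measurable
  have hprob : γ univ = 1 := by
    rw [← preimage_univ (f := Prod.fst), ← Measure.map_apply measurable_fst MeasurableSet.univ,
      hγ.1, measure_univ]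
  have hi₁ : ∫⁻ z, edist (f z.1) (φ z.1) ∂γ = ∫⁻ x, edist (f x) (φ x) ∂μ := by
    rw [← lintegral_map (f := fun x => edist (f x) (φ x)) (by fun_prop) measurable_fst, hγ.1]
  have hi₂ : ∫⁻ z, edist (f z.2) (φ z.2) ∂γ = ∫⁻ x, edist (f x) (φ x) ∂μ := by
    rw [← lintegral_map (f := fun x => edist (f x) (φ x)) (by fun_prop) measurable_snd, hγ.2]
  calc ∫⁻ z, edist (f z.1) (f z.2) ∂γ
      ≤ ∫⁻ z, (edist (f z.1) (φ z.1) + (ε / 4 + C * edist z.1 z.2 ^ 2) +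
          edist (f z.2) (φ z.2)) ∂γ := by
        refine lintegral_mono fun z => ?_
        refine (edist_triangle4 _ (φ z.1) (φ z.2) _).trans ?_
        rw [edist_comm (φ z.2)]
        gcongr
        exact hpt _ _
    _ = ∫⁻ x, edist (f x) (φ x) ∂μ + (ε / 4 + C * transportCost γ) +
          ∫⁻ x, edist (f x) (φ x) ∂μ := by
        rw [lintegral_add_right _ (by fun_prop), lintegral_add_left (by fun_prop),
          lintegral_add_left (by fun_prop), lintegral_const_mul _ (by fun_prop), lintegral_const,
          hprob, mul_one, transportCost, hi₁, hi₂]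
    _ ≤ ε / 4 + (ε / 4 + ε / 4) + ε / 4 := by
        gcongr
        calc C * transportCost γ ≤ C * (ε / 4 / C) := by gcongr
          _ ≤ ε / 4 := ENNReal.mul_div_le
    _ = ε := by
        rw [show ε / 4 + (ε / 4 + ε / 4) + ε / 4 = 4 * (ε / 4) by ring]
        exact ENNReal.mul_div_cancel (by norm_num) (by norm_num)

/-- The tails `(h - R)⁺` of an integrable function have small integral. -/
theorem exists_lintegral_sub_le {X : Type*} [MeasurableSpace X] {ν : Measure X} {h : X → ℝ≥0∞}
    (hm : Measurable h) (hfin : ∫⁻ x, h x ∂ν ≠ ∞) (hh : ∀ x, h x ≠ ∞) {ε : ℝ≥0∞} (hε : ε ≠ 0) :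
    ∃ R : ℝ≥0∞, R ≠ ∞ ∧ ∫⁻ x, (h x - R) ∂ν ≤ ε := by
  have ht : Tendsto (fun n : ℕ => ∫⁻ x, (h x - n) ∂ν) atTop (𝓝 (∫⁻ _, 0 ∂ν)) := by
    refine tendsto_lintegral_of_dominated_convergence h (fun n => hm.sub measurable_const)
      (fun n => Eventually.of_forall fun x => tsub_le_self) hfin (Eventually.of_forall fun x => ?_)
    obtain ⟨N, hN⟩ := ENNReal.exists_nat_gt (hh x)
    refine tendsto_const_nhds.congr' ?_
    filter_upwards [eventually_ge_atTop N] with n hn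
    exact (tsub_eq_zero_of_le (hN.le.trans (by exact_mod_cast hn))).symm
  rw [lintegral_zero] at ht
  obtain ⟨n, hn⟩ := (ht.eventually_lt_const (pos_iff_ne_zero.2 hε)).exists
  exact ⟨n, ENNReal.natCast_ne_top n, hn.le⟩

/-- Turns the leftover weights, written with truncated subtraction, into the oscillation of a real
function, to which the `L¹` approximation applies. -/
theorem tsub_add_tsub_le_two_mul_edist_toReal {a b : ℝ≥0∞} (ha : a ≠ ∞) (hb : b ≠ ∞) :
    (a - b) + (b - a) ≤ 2 * edist a.toReal b.toReal := by
  have key : ∀ {a b : ℝ≥0∞}, a ≠ ∞ → b ≠ ∞ → a - b ≤ edist a.toReal b.toReal := by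
    intro a b ha hb
    rw [edist_dist, Real.dist_eq]
    conv_lhs => rw [← ENNReal.ofReal_toReal ha, ← ENNReal.ofReal_toReal hb]
    rw [← ENNReal.ofReal_sub _ ENNReal.toReal_nonneg]
    exact ENNReal.ofReal_le_ofReal (le_abs_self _)
  rw [two_mul]
  refine add_le_add (key ha hb) ?_
  rw [edist_comm]
  exact key hb ha

/-- Among the plans with first marginal `μ`, the second marginal of `g(x) θ(dx, dy)` depends
continuously on `θ`. -/
theorem exists_transportPlan_restrict_le {X : Type*} [MetricSpace X] [ProperSpace X]
    [MeasurableSpace X] [BorelSpace X] (μ : Measure X) [IsProbabilityMeasure μ]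
    {g : X → ℝ≥0∞} (hg : Measurable g) {K : ℝ≥0∞} (hK : K ≠ ∞) (hgK : ∀ x, g x ≤ K)
    {θ : Measure (X × X)} (hθ : θ.map Prod.fst = μ) {o : X}
    (ho : ∫⁻ y, edist o y ^ 2 ∂θ.map Prod.snd ≠ ∞) {ε : ℝ≥0∞} (hε : ε ≠ 0) :
    ∃ δ : ℝ≥0∞, δ ≠ 0 ∧ ∀ γ : Measure ((X × X) × (X × X)), γ.map Prod.snd = θ →
      (γ.map Prod.fst).map Prod.fst = μ →
      ∫⁻ w, (edist w.1.1 w.2.1 ^ 2 + edist w.1.2 w.2.2 ^ 2) ∂γ ≤ δ →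
      ∃ σ ∈ transportPlans
          (((γ.map Prod.fst).withDensity fun z => g z.1).map Prod.snd)
          ((θ.withDensity fun z => g z.1).map Prod.snd),
        transportCost σ ≤ ε := by
  have hε2 : ε / 2 ≠ 0 := ENNReal.div_ne_zero.2 ⟨hε, by norm_num⟩
  have hε4 : ε / 2 / 4 / 2 ≠ 0 := by
    refine ENNReal.div_ne_zero.2 ⟨ENNReal.div_ne_zero.2 ⟨hε2, ?_⟩, ?_⟩ <;> norm_num
  have hfin : ∀ x, g x ≠ ∞ := fun x => ne_top_of_le_ne_top hK (hgK x)
  have h2K : 2 * K ≠ ∞ := ENNReal.mul_ne_top (by norm_num) hK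
  -- The truncation level depends only on the fixed plan `θ`; no uniform tail bound is available for
  -- the nearby plans.
  obtain ⟨R, hR, hRle⟩ := exists_lintegral_sub_le (ν := θ.map Prod.snd)
    (h := fun y => edist o y ^ 2) (by fun_prop) ho
    (fun y => ENNReal.pow_ne_top (edist_ne_top _ _))
    (ENNReal.div_ne_zero.2 ⟨hε4, h2K⟩)
  have hgL : MemLp (fun x => (g x).toReal) 1 μ := by
    refine MemLp.of_bound hg.ennreal_toReal.aestronglyMeasurable K.toReal
      (Eventually.of_forall fun x => ?_)
    rw [Real.norm_of_nonneg ENNReal.toReal_nonneg]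
    exact ENNReal.toReal_mono hK (hgK x)
  have h2R : 2 * R ≠ ∞ := ENNReal.mul_ne_top (by norm_num) hR
  obtain ⟨δ, hδ, hmod⟩ := exists_lintegral_edist_comp_le μ hgL hg.ennreal_toReal
    (ENNReal.div_ne_zero.2 ⟨hε4, h2R⟩)
  have h5K : 5 * K ≠ ∞ := ENNReal.mul_ne_top (by norm_num) hK
  refine ⟨min δ (ε / 2 / (5 * K)), (lt_min (pos_iff_ne_zero.2 hδ)
    (pos_iff_ne_zero.2 (ENNReal.div_ne_zero.2 ⟨hε2, h5K⟩))).ne', fun γ hγs hγf hcost => ?_⟩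
  have hf₁ : (γ.map fun w => w.1.1) = μ := by
    rw [← hγf, Measure.map_map measurable_fst measurable_fst]; rfl
  have hf₂ : (γ.map fun w => w.2.1) = μ := by
    rw [← hθ, ← hγs, Measure.map_map measurable_fst measurable_snd]; rfl
  have hs₂ : (γ.map fun w => w.2.2) = θ.map Prod.snd := by
    rw [← hγs, Measure.map_map measurable_snd measurable_snd]; rfl
  have hga : Measurable fun w : (X × X) × (X × X) => g w.1.1 := by fun_prop
  have hgb : Measurable fun w : (X × X) × (X × X) => g w.2.1 := by fun_prop
  have hia : ∫⁻ w, g w.1.1 ∂γ = ∫⁻ x, g x ∂μ := by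
    rw [← hf₁, lintegral_map hg (by fun_prop)]
  have hib : ∫⁻ w, g w.2.1 ∂γ = ∫⁻ x, g x ∂μ := by
    rw [← hf₂, lintegral_map hg (by fun_prop)]
  have hgfin : ∫⁻ x, g x ∂μ ≠ ∞ := by
    refine ne_top_of_le_ne_top hK ((lintegral_mono hgK).trans_eq ?_)
    simp
  obtain ⟨σ, hσ, hσc⟩ := exists_transportPlan_withDensity γ hga hgb (hia.trans hib.symm)
    (hia ▸ hgfin) (p := fun w => w.1.2) (q := fun w => w.2.2) (by fun_prop) (by fun_prop) o
  refine ⟨σ, ?_, hσc.trans ?_⟩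
  · convert hσ using 2
    · rw [← map_withDensity_comp γ measurable_fst (f := fun z => g z.1) (by fun_prop),
        Measure.map_map measurable_snd measurable_fst]
      rfl
    · rw [← hγs, ← map_withDensity_comp γ measurable_snd (f := fun z => g z.1) (by fun_prop),
        Measure.map_map measurable_snd measurable_snd]
      rfl
  set D := ∫⁻ w, edist w.1.2 w.2.2 ^ 2 ∂γ with hD
  -- The final bound is `5 * K * D + 4 * E`, each term getting `ε / 2`. In `E` the squared distance
  -- is cut at `R`: below, the oscillation of `g` is small; above, it is at most `2 * K` and the
  -- tail is small.
  set E := ∫⁻ w, ((g w.1.1 - g w.2.1) + (g w.2.1 - g w.1.1)) * edist o w.2.2 ^ 2 ∂γ with hE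
  have hDle : D ≤ ε / 2 / (5 * K) := by
    refine le_trans (lintegral_mono fun w => ?_) (hcost.trans (min_le_right _ _))
    exact le_add_self
  have hosc : ∫⁻ w, ((g w.1.1 - g w.2.1) + (g w.2.1 - g w.1.1)) ∂γ ≤
      2 * (ε / 2 / 4 / 2 / (2 * R)) := by
    have hm : Measurable fun w : (X × X) × (X × X) => (w.1.1, w.2.1) := by fun_prop
    have hpl : γ.map (fun w => (w.1.1, w.2.1)) ∈ transportPlans μ μ := by
      constructor
      · rw [Measure.map_map measurable_fst hm]; exact hf₁
      · rw [Measure.map_map measurable_snd hm]; exact hf₂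
    have hc : transportCost (γ.map fun w => (w.1.1, w.2.1)) ≤ δ := by
      rw [transportCost, lintegral_map (by fun_prop) hm]
      refine le_trans (lintegral_mono fun w => ?_) (hcost.trans (min_le_left _ _))
      exact le_self_add
    have h := hmod _ hpl hc
    have hme : Measurable fun z : X × X => edist (g z.1).toReal (g z.2).toReal :=
      (hg.comp measurable_fst).ennreal_toReal.edist (hg.comp measurable_snd).ennreal_toReal
    rw [lintegral_map hme hm] at h
    refine (lintegral_mono fun w : (X × X) × (X × X) => tsub_add_tsub_le_two_mul_edist_toReal
      (hfin w.1.1) (hfin w.2.1)).trans ?_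
    exact (lintegral_const_mul _ (hme.comp hm)).trans_le (by gcongr; exact h)
  have hEle : E ≤ ε / 2 / 4 := by
    calc E ≤ ∫⁻ w, (R * ((g w.1.1 - g w.2.1) + (g w.2.1 - g w.1.1)) +
            2 * K * (edist o w.2.2 ^ 2 - R)) ∂γ := by
          refine lintegral_mono fun w => ?_
          dsimp only
          have h₁ : edist o w.2.2 ^ 2 ≤ R + (edist o w.2.2 ^ 2 - R) := le_add_tsub
          have h₂ : (g w.1.1 - g w.2.1) + (g w.2.1 - g w.1.1) ≤ 2 * K := by
            rw [two_mul]
            exact add_le_add (tsub_le_self.trans (hgK _)) (tsub_le_self.trans (hgK _))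
          refine (mul_le_mul_right h₁ _).trans ?_
          rw [mul_add, mul_comm _ R]
          gcongr
      _ = R * ∫⁻ w, ((g w.1.1 - g w.2.1) + (g w.2.1 - g w.1.1)) ∂γ +
            2 * K * ∫⁻ y, (edist o y ^ 2 - R) ∂θ.map Prod.snd := by
          rw [lintegral_add_left (by fun_prop), lintegral_const_mul _ (by fun_prop),
            lintegral_const_mul _ (by fun_prop), ← hs₂,
            lintegral_map (f := fun y => edist o y ^ 2 - R) (by fun_prop) (by fun_prop)]
      _ ≤ R * (2 * (ε / 2 / 4 / 2 / (2 * R))) + 2 * K * (ε / 2 / 4 / 2 / (2 * K)) := by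
          gcongr
      _ = 2 * R * (ε / 2 / 4 / 2 / (2 * R)) + 2 * K * (ε / 2 / 4 / 2 / (2 * K)) := by ring
      _ ≤ ε / 2 / 4 / 2 + ε / 2 / 4 / 2 := add_le_add ENNReal.mul_div_le ENNReal.mul_div_le
      _ = ε / 2 / 4 := ENNReal.add_halves _
  calc ∫⁻ w, min (g w.1.1) (g w.2.1) * edist w.1.2 w.2.2 ^ 2 ∂γ +
        (2 * ∫⁻ w, (g w.1.1 - g w.2.1) * edist o w.1.2 ^ 2 ∂γ +
          2 * ∫⁻ w, (g w.2.1 - g w.1.1) * edist o w.2.2 ^ 2 ∂γ)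
      -- The moment at the perturbed endpoint `w.1.2` is transferred to `w.2.2`, whose law is fixed,
      -- at the price of further multiples of `K * D`.
      ≤ K * D + (2 * (2 * (K * D) +
          2 * ∫⁻ w, (g w.1.1 - g w.2.1) * edist o w.2.2 ^ 2 ∂γ) +
          4 * ∫⁻ w, (g w.2.1 - g w.1.1) * edist o w.2.2 ^ 2 ∂γ) := by
        refine add_le_add ?_ (add_le_add (mul_le_mul_right ?_ 2)
          (mul_le_mul_left (by norm_num) _))
        · rw [hD, ← lintegral_const_mul _ (by fun_prop)]
          refine lintegral_mono fun w => ?_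
          dsimp only
          gcongr
          exact (min_le_left _ _).trans (hgK _)
        · rw [hD, ← lintegral_const_mul _ (by fun_prop), ← lintegral_const_mul _ (by fun_prop),
            ← lintegral_const_mul _ (by fun_prop), ← lintegral_add_left (by fun_prop)]
          refine lintegral_mono fun w => ?_
          dsimp only
          have h := edist_sq_le_two_mul o w.2.2 w.1.2
          have hle : g w.1.1 - g w.2.1 ≤ K := tsub_le_self.trans (hgK _)
          calc (g w.1.1 - g w.2.1) * edist o w.1.2 ^ 2
              ≤ (g w.1.1 - g w.2.1) * (2 * edist o w.2.2 ^ 2 + 2 * edist w.2.2 w.1.2 ^ 2) := by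
                gcongr
            _ = 2 * ((g w.1.1 - g w.2.1) * edist w.1.2 w.2.2 ^ 2) +
                  2 * ((g w.1.1 - g w.2.1) * edist o w.2.2 ^ 2) := by
                rw [edist_comm w.2.2]; ring
            _ ≤ _ := by gcongr
    _ = 5 * K * D + 4 * E := by
        rw [hE]
        simp_rw [add_mul]
        rw [lintegral_add_left (by fun_prop)]
        ring
    _ ≤ 5 * K * (ε / 2 / (5 * K)) + 4 * (ε / 2 / 4) := by gcongr
    _ ≤ ε / 2 + ε / 2 := add_le_add ENNReal.mul_div_le ENNReal.mul_div_le
    _ = ε := ENNReal.add_halves _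

/-! ### Borel measurability of the restriction mapping. -/

namespace Decomposition

variable {X : Type*} [MetricSpace X] [ProperSpace X] [MeasurableSpace X] [BorelSpace X] {μ : W2 X}

/-- Restriction is continuous with respect to the distance between the selected plans. -/
theorem exists_edist_restriction_lt (D : Decomposition μ) (S : OptimalSelection X) (i : Fin 2)
    (ν : W2 X) {ε : ℝ≥0∞} (hε : ε ≠ 0) :
    ∃ δ : ℝ≥0∞, δ ≠ 0 ∧ ∀ ν' : W2 X, edist (S.plan (μ, ν')) (S.plan (μ, ν)) < δ →
      edist (D.restriction S i ν') (D.restriction S i ν) ≤ ε := by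
  obtain ⟨K, hK, hKae⟩ := D.exists_density_le i
  -- Truncation makes the bound hold everywhere. It changes the density on a `μ`-null set only,
  -- which is invisible to every plan with first marginal `μ`.
  set g : X → ℝ≥0∞ := fun x => min (D.density i x) K with hg
  have hgm : Measurable g := (D.measurable_density i).min measurable_const
  have hgae : D.density i =ᵐ[μ.toMeasure] g := by
    filter_upwards [hKae] with x hx
    exact (min_eq_left hx).symm
  set pl : W2 X → Measure (X × X) :=
    fun ρ => (S.plan (μ, ρ)).toMeasure.map WithLp.ofLp with hpl
  have hfst : ∀ ρ, (pl ρ).map Prod.fst = μ.toMeasure := fun ρ => (S.optimal μ ρ).1.1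
  have hres : ∀ ρ, (D.restriction S i ρ).toMeasure =
      ((pl ρ).withDensity fun z => g z.1).map Prod.snd := fun ρ => by
    change ((pl ρ).withDensity fun z => D.density i z.1).map Prod.snd = _
    congr 1
    refine withDensity_congr_ae ?_
    rw [← hfst ρ] at hgae
    exact ae_of_ae_map measurable_fst.aemeasurable hgae
  obtain ⟨o, ho⟩ := ν.moment
  have ho' : ∫⁻ y, edist o y ^ 2 ∂(pl ν).map Prod.snd ≠ ∞ := by
    rw [show (pl ν).map Prod.snd = ν.toMeasure from (S.optimal μ ν).1.2]
    exact ho.ne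
  have hε2 : ε ^ (2 : ℝ) ≠ 0 := by simpa using hε
  obtain ⟨δ, hδ, hδγ⟩ := exists_transportPlan_restrict_le μ.toMeasure hgm hK
    (fun x => min_le_right _ _) (hfst ν) ho' hε2
  refine ⟨δ ^ (1 / 2 : ℝ), by simpa using hδ, fun ν' hν' => ?_⟩
  obtain ⟨Γ, hΓ, hΓc⟩ := W2.exists_plan_of_edist_lt hν'
  have hΓδ : transportCost Γ ≤ δ :=
    ((ENNReal.rpow_lt_rpow_iff (by norm_num)).1 hΓc).le
  have hL : Measurable (WithLp.ofLp : WithLp 2 (X × X) → X × X) := WithLp.measurable_ofLp _ _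
  have hLL : Measurable (Prod.map (WithLp.ofLp : WithLp 2 (X × X) → X × X)
      (WithLp.ofLp : WithLp 2 (X × X) → X × X)) := hL.prodMap hL
  have h₁ : (Γ.map (Prod.map WithLp.ofLp WithLp.ofLp)).map Prod.fst = pl ν' := by
    rw [hpl, Measure.map_map measurable_fst hLL]
    dsimp only
    rw [← hΓ.1, Measure.map_map hL measurable_fst]
    rfl
  have h₂ : (Γ.map (Prod.map WithLp.ofLp WithLp.ofLp)).map Prod.snd = pl ν := by
    rw [hpl, Measure.map_map measurable_snd hLL]
    dsimp only
    rw [← hΓ.2, Measure.map_map hL measurable_snd]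
    rfl
  obtain ⟨σ, hσ, hσc⟩ := hδγ _ h₂ (h₁ ▸ hfst ν') (by
    rw [lintegral_map (by fun_prop) hLL]
    refine le_trans (lintegral_mono fun w => le_of_eq ?_) hΓδ
    -- The squared `ℓ²` distance is the sum of the squared coordinate distances, so the cost of `Γ`
    -- is exactly the quantity bounded by `δ`.
    have hsq : ∀ a b : ℝ≥0∞, a ^ 2 + b ^ 2 =
        ((a ^ (2 : ℝ≥0∞).toReal + b ^ (2 : ℝ≥0∞).toReal) ^ (1 / (2 : ℝ≥0∞).toReal)) ^ 2 := by
      intro a b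
      rw [← ENNReal.rpow_two (x := _ ^ _), ← ENNReal.rpow_mul]
      simp
    rw [WithLp.prod_edist_eq_add (by norm_num)]
    exact hsq _ _)
  rw [h₁, ← hres, ← hres] at hσ
  refine (W2.edist_le_of_mem_transportPlans hσ).trans ?_
  calc transportCost σ ^ (1 / 2 : ℝ) ≤ (ε ^ (2 : ℝ)) ^ (1 / 2 : ℝ) := by gcongr
    _ = ε := by rw [← ENNReal.rpow_mul]; norm_num

/-- The map is continuous for the topology pulled back along `ν ↦ S.plan (μ, ν)`. An open set thus
has as preimage the plan-preimage of an open set, which is Borel; no countable cover by balls is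
needed. -/
theorem measurable_restriction (D : Decomposition μ) (S : OptimalSelection X) (i : Fin 2) :
    Measurable (D.restriction S i) := by
  have hplan : Measurable fun ν => S.plan (μ, ν) :=
    S.measurable_plan.comp measurable_prodMk_left
  have hcont : @Continuous _ _ (TopologicalSpace.induced (fun ν => S.plan (μ, ν))
      W2.instTopologicalSpace) W2.instTopologicalSpace (D.restriction S i) := by
    refine continuous_generateFrom_iff.2 ?_
    rintro _ ⟨ρ, r, rfl⟩
    refine (@isOpen_iff_mem_nhds _ (TopologicalSpace.induced (fun ν => S.plan (μ, ν))
      W2.instTopologicalSpace) _).2 fun ν hν => ?_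
    change edist (D.restriction S i ν) ρ < r at hν
    obtain ⟨ε, hε, hlt⟩ : ∃ ε : ℝ≥0∞, ε ≠ 0 ∧ ε + edist (D.restriction S i ν) ρ < r := by
      obtain ⟨ε, hε, h⟩ := ENNReal.lt_iff_exists_add_pos_lt.1 hν
      exact ⟨ε, by exact_mod_cast hε.ne', by rwa [add_comm]⟩
    obtain ⟨δ, hδ, hδν⟩ := D.exists_edist_restriction_lt S i ν hε
    rw [nhds_induced]
    -- Balls are open by definition of the topology; that this one contains its centre is
    -- `W2.edist_self`.
    refine ⟨{θ | edist θ (S.plan (μ, ν)) < δ}, ?_, fun ν' hν' => ?_⟩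
    · refine IsOpen.mem_nhds (TopologicalSpace.isOpen_generateFrom_of_mem ⟨_, _, rfl⟩) ?_
      change edist _ _ < δ
      rw [W2.edist_self]
      exact pos_iff_ne_zero.2 hδ
    · exact ((W2.edist_triangle _ (D.restriction S i ν) _).trans
        (by gcongr; exact hδν ν' hν')).trans_lt hlt
  refine measurable_of_isOpen fun U hU => ?_
  obtain ⟨V, hV, hVU⟩ := @IsOpen.preimage _ _ (TopologicalSpace.induced
    (fun ν => S.plan (μ, ν)) W2.instTopologicalSpace) _ _ hcont U hU
  rw [← hVU]
  exact hplan hV.measurableSet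

end Decomposition

end

/-! ### Transfer of absolute continuity to the pushforward. -/

theorem corollary2p32 {X : Type*} [MetricSpace X] [ProperSpace X] [MeasurableSpace X]
    [BorelSpace X] (S : OptimalSelection X) (P : W2 (W2 X)) (μ : W2 X) (hμ : IsBarycenter P μ)
    (D : Decomposition μ) (η : Measure X) (i : Fin 2) :
    (0 < P.toMeasure (acMeasures η) →
      0 < (P.toMeasure.map (D.restriction S i)) (acMeasures η)) ∧
    (P.toMeasure (acMeasures η) = 1 →
      (P.toMeasure.map (D.restriction S i)) (acMeasures η) = 1) := by
  have hR : AEMeasurable (D.restriction S i) P.toMeasure :=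
    (D.measurable_restriction S i).aemeasurable
  have hsub : acMeasures η ⊆ D.restriction S i ⁻¹' acMeasures η := fun ν hν => by
    obtain ⟨K, -, hK⟩ := D.exists_restrictMeasure_le S i ν
    exact (Measure.absolutelyContinuous_of_le hK).trans (hν.smul_left K)
  -- `Measure.le_map_apply` holds for arbitrary sets, so outer measures are covered when `A_η` is
  -- not Borel.
  have hle : P.toMeasure (acMeasures η) ≤
      (P.toMeasure.map (D.restriction S i)) (acMeasures η) :=
    (measure_mono hsub).trans (Measure.le_map_apply hR _)
  have : IsProbabilityMeasure (P.toMeasure.map (D.restriction S i)) :=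
    Measure.isProbabilityMeasure_map hR
  exact ⟨fun h => h.trans_le hle, fun h => le_antisymm prob_le_one (h ▸ hle)⟩
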